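/- Let $d\ge 0$ be an integer and let $ID$ be the class of infinitely divisible distributions on $\mathbb R^d$. For $\mu\in ID$ write the Lévy–Khintchine representation of its characteristic function as $$\hat\mu(z)=\exp\Bigl[-\tfrac12\langle z,A_\mu z\rangle+\int_{\mathbb R^d}\bigl(e^{i\langle z,x\rangle}-1-i\langle z,x\rangle 1_{\{|x|\le 1\}}(x)\bigr)\,\nu_\mu(dx)+i\langle\gamma_\mu,z\rangle\Bigr],\qquad z\in\mathbb R^d,$$ where $A_\mu$ is a symmetric nonnegative-definite matrix, $\gamma_\mu\in\mathbb R^d$, and $\nu_\mu$ is a measure on $\mathbb R^d$ with $\nu_\mu(\{0\})=0$ and $\int_{\mathbb R^d}(|x|^2\wedge 1)\,\nu_\mu(dx)<\infty$. Let $ID_0=\{\mu\in ID: A_\mu=0\}$. For $\mu\in ID$ and $s\in\mathbb R$, let $\hat\mu(z)^s=e^{s\psi(z)}$, where $\psi$ is the continuous function on $\mathbb R^d$ with $\psi(0)=0$ and $e^{\psi}=\hat\mu$. A distribution $\mu'\in ID_0$ is called the inversion of $\mu\in ID_0$ if $$\nu_{\mu'}(B)=\int_{\mathbb R^d\setminus\{0\}}1_B(|x|^{-2}x)\,|x|^2\,\nu_\mu(dx)\quad\text{for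 every Borel set }B\subset\mathbb R^d,\qquad \gamma_{\mu'}=-\gamma_\mu+\int_{|x|=1}x\,\nu_\mu(dx).$$ For $\alpha\in\mathbb R$, let $L^{\langle\alpha\rangle}$ be the class of $\alpha$-selfdecomposable distributions, that is, of all $\mu\in ID$ such that for every $b>1$ there is $\rho_b\in ID$ with $\hat\mu(z)=\hat\mu(b^{-1}z)^{b^{\alpha}}\hat\rho_b(z)$ for all $z\in\mathbb R^d$. Let $L^{\langle\alpha\rangle*}$ be the class of all $\mu\in ID$ such that for every $b>1$ there is $\sigma_b\in ID$ with $\hat\mu(z)=\hat\mu(bz)^{b^{\alpha-2}}\hat\sigma_b(z)$ for all $z\in\mathbb R^d$. Theorem. Let $\alpha\in\mathbb R$ and $\mu\in ID_0$. Then $\mu$ has exactly one inversion $\mu'$, and $\mu\in L^{\langle\alpha\rangle}$ if and only if $\mu'\in L^{\langle\alpha\rangle*}$. -/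

import Mathlib

open MeasureTheory

/-- The `n`-fold convolution power of a measure on `ℝ^d` (the unit mass at `0` for `n = 0`). -/
noncomputable def convPower {d : ℕ} (ρ : Measure (EuclideanSpace ℝ (Fin d))) :
    ℕ → Measure (EuclideanSpace ℝ (Fin d))
  | 0 => Measure.dirac 0
  | n + 1 => Measure.conv (convPower ρ n) ρ

/-- The class `ID` of infinitely divisible distributions on `ℝ^d`: probability measures that have,
for every `n ≥ 1`, an `n`-th convolution root among the probability measures. -/
def IsInfinitelyDivisible {d : ℕ} (μ : Measure (EuclideanSpace ℝ (Fin d))) : Prop :=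
  IsProbabilityMeasure μ ∧
    ∀ n : ℕ, 1 ≤ n → ∃ ρ : Measure (EuclideanSpace ℝ (Fin d)),
      IsProbabilityMeasure ρ ∧ convPower ρ n = μ

/-- Lévy measures on `ℝ^d`: no mass at `0` and `∫ (|x|² ∧ 1) ν(dx) < ∞`. -/
def IsLevyMeasure {d : ℕ} (ν : Measure (EuclideanSpace ℝ (Fin d))) : Prop :=
  ν {0} = 0 ∧ ∫⁻ x, ENNReal.ofReal (min (‖x‖ ^ 2) 1) ∂ν < ⊤

/-- The integrand `e^{i⟨z,x⟩} - 1 - i⟨z,x⟩ 1_{|x| ≤ 1}` of the Lévy–Khintchine representation. -/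
noncomputable def levyKhintchineIntegrand {d : ℕ} (z x : EuclideanSpace ℝ (Fin d)) : ℂ :=
  Complex.exp ((inner ℝ z x : ℝ) * Complex.I) - 1
    - (Metric.closedBall (0 : EuclideanSpace ℝ (Fin d)) 1).indicator
        (fun y => ((inner ℝ z y : ℝ) : ℂ) * Complex.I) x

/-- `(A, ν, γ)` is the Lévy–Khintchine triplet of `μ`: Gaussian covariance matrix, Lévy measure
and location parameter (with respect to the truncation function `1_{|x| ≤ 1}`). -/
structure HasLevyTriplet {d : ℕ} (μ : Measure (EuclideanSpace ℝ (Fin d)))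
    (A : Matrix (Fin d) (Fin d) ℝ) (ν : Measure (EuclideanSpace ℝ (Fin d)))
    (γ : EuclideanSpace ℝ (Fin d)) : Prop where
  posSemidef : A.PosSemidef
  levyMeasure : IsLevyMeasure ν
  charFun_eq : ∀ z : EuclideanSpace ℝ (Fin d), charFun μ z =
    Complex.exp (-(1 / 2 : ℂ) * ((WithLp.ofLp z ⬝ᵥ A.mulVec (WithLp.ofLp z) : ℝ) : ℂ)
      + ∫ x, levyKhintchineIntegrand z x ∂ν
      + ((inner ℝ γ z : ℝ) : ℂ) * Complex.I)

/-- The class `ID₀` of infinitely divisible distributions on `ℝ^d` without Gaussian part. -/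
def IsInfinitelyDivisibleZero {d : ℕ} (μ : Measure (EuclideanSpace ℝ (Fin d))) : Prop :=
  IsInfinitelyDivisible μ ∧
    ∃ (ν : Measure (EuclideanSpace ℝ (Fin d))) (γ : EuclideanSpace ℝ (Fin d)),
      HasLevyTriplet μ 0 ν γ

/-- The geometric inversion `ι(x) = |x|⁻² x` (used only for `x ≠ 0`). -/
noncomputable def geometricInversion {d : ℕ} (x : EuclideanSpace ℝ (Fin d)) :
    EuclideanSpace ℝ (Fin d) :=
  (‖x‖ ^ 2)⁻¹ • x

/-- `μ'` is the inversion of `μ`: both lie in `ID₀` and their Lévy measures and location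
parameters satisfy `ν_{μ'}(B) = ∫_{x ≠ 0} 1_B(ι(x)) |x|² ν_μ(dx)` and
`γ_{μ'} = -γ_μ + ∫_{|x| = 1} x ν_μ(dx)`. -/
def IsInversion {d : ℕ} (μ μ' : Measure (EuclideanSpace ℝ (Fin d))) : Prop :=
  IsInfinitelyDivisibleZero μ ∧ IsInfinitelyDivisibleZero μ' ∧
    ∃ (ν ν' : Measure (EuclideanSpace ℝ (Fin d))) (γ γ' : EuclideanSpace ℝ (Fin d)),
      HasLevyTriplet μ 0 ν γ ∧ HasLevyTriplet μ' 0 ν' γ' ∧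
      (∀ B : Set (EuclideanSpace ℝ (Fin d)), MeasurableSet B →
        ν' B = ∫⁻ x in {0}ᶜ,
          B.indicator 1 (geometricInversion x) * ENNReal.ofReal (‖x‖ ^ 2) ∂ν) ∧
      γ' = -γ + ∫ x in Metric.sphere (0 : EuclideanSpace ℝ (Fin d)) 1, x ∂ν

/-- `ψ` is the distinguished logarithm of the characteristic function of `μ`: the continuous
function with `ψ(0) = 0` and `e^ψ = μ̂`. Real powers of the characteristic function of an infinitely
divisible distribution are understood as `μ̂(z)^s = e^{s ψ(z)}`. -/
structure IsDistinguishedLog {d : ℕ} (μ : Measure (EuclideanSpace ℝ (Fin d)))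
    (ψ : EuclideanSpace ℝ (Fin d) → ℂ) : Prop where
  continuous : Continuous ψ
  map_zero : ψ 0 = 0
  exp_eq : ∀ z, Complex.exp (ψ z) = charFun μ z

/-- The class `L^{⟨α⟩}` of `α`-selfdecomposable distributions: for every `b > 1` there is
`ρ_b ∈ ID` with `μ̂(z) = μ̂(b⁻¹ z)^{b^α} ρ̂_b(z)`. -/
def IsSelfdecomposableOfIndex {d : ℕ} (α : ℝ) (μ : Measure (EuclideanSpace ℝ (Fin d))) : Prop :=
  IsInfinitelyDivisible μ ∧
    ∃ ψ : EuclideanSpace ℝ (Fin d) → ℂ, IsDistinguishedLog μ ψ ∧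
      ∀ b : ℝ, 1 < b → ∃ ρ : Measure (EuclideanSpace ℝ (Fin d)), IsInfinitelyDivisible ρ ∧
        ∀ z, charFun μ z =
          Complex.exp (((b ^ α : ℝ) : ℂ) * ψ (b⁻¹ • z)) * charFun ρ z

/-- The class `L^{⟨α⟩*}`: for every `b > 1` there is `σ_b ∈ ID` with
`μ̂(z) = μ̂(b z)^{b^{α-2}} σ̂_b(z)`. -/
def IsDualSelfdecomposableOfIndex {d : ℕ} (α : ℝ) (μ : Measure (EuclideanSpace ℝ (Fin d))) :
    Prop :=
  IsInfinitelyDivisible μ ∧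
    ∃ ψ : EuclideanSpace ℝ (Fin d) → ℂ, IsDistinguishedLog μ ψ ∧
      ∀ b : ℝ, 1 < b → ∃ σ : Measure (EuclideanSpace ℝ (Fin d)), IsInfinitelyDivisible σ ∧
        ∀ z, charFun μ z =
          Complex.exp (((b ^ (α - 2) : ℝ) : ℂ) * ψ (b • z)) * charFun σ z

open Filter Topology

/-! Both classes can be read off the Lévy measure. A factor `μ̂(cz)^s` splits off within `ID`
exactly when `s` times the image of `ν` under `x ↦ c x` is at most `ν`
(`HasLevyTriplet.exists_factor_iff`); drifts are unconstrained and play no role. Inversion acts on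
Lévy measures by weighting with `|x|²` and pushing forward along `ι`. This is a monotone involution,
and since `ι(cx) = c⁻¹ι(x)` and `|cx|² = c²|x|²`, it sends dilation by `c` with weight `s` to
dilation by `c⁻¹` with weight `s c²`. For `c = b⁻¹` and `s = b^α` the new weight is `b^(α-2)`, so
the two domination conditions correspond (`levyInversion_dilation_le_iff`).

The analytic core is `IsInfinitelyDivisible.levyMeasure_le`: if an infinitely divisible law has
exponent `φ` with jump part the difference of those of `ν₁` and `ν₂`, then `ν₂ ≤ ν₁`. Its `n`-th
roots `κₙ` have transform `e^(φ/n)`, so the measures `n (1 - cos⟨w,x⟩) κₙ(dx)` have transforms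
converging to a second difference of `φ`, the transform of the damped `ν₁` minus the damped `ν₂`. By
Lévy's continuity theorem that difference is a positive measure; countably many `w` then remove the
damping. Applied to `δ₀`, this also gives uniqueness of the triplet. Conversely, compound Poisson
limits realise any Lévy measure and drift, which yields both the cofactor and the inversion. -/

/-- The jump part `∫ (e^{i⟨z,x⟩} - 1 - i⟨z,x⟩ 1_{|x| ≤ 1}) ν(dx)` of the Lévy–Khintchine exponent. -/
noncomputable def levyExponent {d : ℕ} (ν : Measure (EuclideanSpace ℝ (Fin d)))
    (z : EuclideanSpace ℝ (Fin d)) : ℂ :=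
  ∫ x, levyKhintchineIntegrand z x ∂ν

/-! ### Lévy exponents: bounds, continuity, dilation. -/

section Integrand

variable {d : ℕ}

theorem norm_exp_ofReal_mul_I_sub_one_sub_le (u : ℝ) :
    ‖Complex.exp (u * Complex.I) - 1 - u * Complex.I‖ ≤ 3 * u ^ 2 := by
  have hn : ‖(u : ℂ) * Complex.I‖ = |u| := by simp
  rcases le_total |u| 1 with h | h
  · refine (Complex.norm_exp_sub_one_sub_id_le (hn.trans_le h)).trans ?_
    rw [hn, sq_abs]
    nlinarith [sq_nonneg u]
  · have h1 : ‖Complex.exp (u * Complex.I)‖ = 1 := Complex.norm_exp_ofReal_mul_I u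
    have h2 : ‖Complex.exp (u * Complex.I) - 1 - u * Complex.I‖ ≤ 1 + 1 + |u| := by
      refine (norm_sub_le _ _).trans (add_le_add ((norm_sub_le _ _).trans ?_) hn.le)
      rw [h1, norm_one]
    rw [← sq_abs u]
    nlinarith

/-- Taylor expansion to second order inside the unit ball and boundedness outside match the
integrability condition on a Lévy measure. -/
theorem norm_levyKhintchineIntegrand_le (z x : EuclideanSpace ℝ (Fin d)) :
    ‖levyKhintchineIntegrand z x‖ ≤ (2 + 3 * ‖z‖ ^ 2) * min (‖x‖ ^ 2) 1 := by
  unfold levyKhintchineIntegrand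
  by_cases hx : ‖x‖ ≤ 1
  · rw [Set.indicator_of_mem (by simpa using hx), min_eq_left (by nlinarith [norm_nonneg x])]
    refine (norm_exp_ofReal_mul_I_sub_one_sub_le _).trans ?_
    have h := abs_real_inner_le_norm z x
    have h2 : (inner ℝ z x) ^ 2 ≤ (‖z‖ * ‖x‖) ^ 2 := sq_le_sq' (by linarith [neg_abs_le (inner ℝ z x)])
      ((le_abs_self _).trans h)
    nlinarith [sq_nonneg ‖x‖]
  · rw [Set.indicator_of_notMem (by simpa using hx), sub_zero,
      min_eq_right (by nlinarith [norm_nonneg x])]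
    refine (norm_sub_le _ _).trans ?_
    rw [Complex.norm_exp_ofReal_mul_I, norm_one]
    nlinarith [sq_nonneg ‖z‖]

theorem measurable_levyKhintchineIntegrand (z : EuclideanSpace ℝ (Fin d)) :
    Measurable (levyKhintchineIntegrand z) := by
  unfold levyKhintchineIntegrand
  refine Measurable.sub (by fun_prop) (Measurable.indicator (by fun_prop) measurableSet_closedBall)

theorem continuous_levyKhintchineIntegrand_left (x : EuclideanSpace ℝ (Fin d)) :
    Continuous (fun z => levyKhintchineIntegrand z x) := by
  unfold levyKhintchineIntegrand
  refine Continuous.sub (by fun_prop) ?_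
  by_cases hx : x ∈ Metric.closedBall (0 : EuclideanSpace ℝ (Fin d)) 1
  · simp only [Set.indicator_of_mem hx]; fun_prop
  · simp only [Set.indicator_of_notMem hx]; fun_prop

variable {ν ν₁ ν₂ : Measure (EuclideanSpace ℝ (Fin d))}

theorem IsLevyMeasure.integrable_min (hν : IsLevyMeasure ν) :
    Integrable (fun x => min (‖x‖ ^ 2) 1) ν := by
  refine ⟨by fun_prop, ?_⟩
  rw [hasFiniteIntegral_iff_ofReal (ae_of_all _ fun x => by positivity)]
  exact hν.2

theorem IsLevyMeasure.mono (hν : IsLevyMeasure ν) (h : ν₁ ≤ ν) : IsLevyMeasure ν₁ :=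
  ⟨le_antisymm ((h _).trans hν.1.le) zero_le, (lintegral_mono' h le_rfl).trans_lt hν.2⟩

theorem IsLevyMeasure.smul (hν : IsLevyMeasure ν) {c : ENNReal} (hc : c ≠ ⊤) :
    IsLevyMeasure (c • ν) :=
  ⟨by simp [hν.1], by
    rw [lintegral_smul_measure]
    exact ENNReal.mul_lt_top hc.lt_top hν.2⟩

theorem IsLevyMeasure.integrable_integrand (hν : IsLevyMeasure ν)
    (z : EuclideanSpace ℝ (Fin d)) : Integrable (levyKhintchineIntegrand z) ν :=
  (hν.integrable_min.const_mul (2 + 3 * ‖z‖ ^ 2)).mono'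
    (measurable_levyKhintchineIntegrand z).aestronglyMeasurable
    (ae_of_all _ (norm_levyKhintchineIntegrand_le z))

@[simp]
theorem levyExponent_zero_right : levyExponent ν 0 = 0 := by
  simp [levyExponent, levyKhintchineIntegrand]

theorem IsLevyMeasure.continuous_levyExponent (hν : IsLevyMeasure ν) :
    Continuous (levyExponent ν) := by
  rw [continuous_iff_continuousAt]
  intro z₀
  refine continuousAt_of_dominated
    (bound := fun x => (2 + 3 * (‖z₀‖ + 1) ^ 2) * min (‖x‖ ^ 2) 1) ?_ ?_ ?_ ?_
  · exact .of_forall fun z => (measurable_levyKhintchineIntegrand z).aestronglyMeasurable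
  · filter_upwards [Metric.ball_mem_nhds z₀ one_pos] with z hz
    refine ae_of_all _ fun x => (norm_levyKhintchineIntegrand_le z x).trans ?_
    have : ‖z‖ ≤ ‖z₀‖ + 1 := by
      have := norm_sub_norm_le z z₀
      rw [Metric.mem_ball, dist_eq_norm] at hz
      linarith
    gcongr
  · exact hν.integrable_min.const_mul _
  · exact ae_of_all _ fun x => (continuous_levyKhintchineIntegrand_left x).continuousAt

theorem levyExponent_add (h₁ : IsLevyMeasure ν₁) (h₂ : IsLevyMeasure ν₂)
    (z : EuclideanSpace ℝ (Fin d)) :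
    levyExponent (ν₁ + ν₂) z = levyExponent ν₁ z + levyExponent ν₂ z :=
  integral_add_measure (h₁.integrable_integrand z) (h₂.integrable_integrand z)

theorem levyExponent_smul {s : ℝ} (hs : 0 ≤ s) (z : EuclideanSpace ℝ (Fin d)) :
    levyExponent (ENNReal.ofReal s • ν) z = s * levyExponent ν z := by
  rw [levyExponent, integral_smul_measure, ENNReal.toReal_ofReal hs]
  rfl

theorem IsLevyMeasure.map_smul (hν : IsLevyMeasure ν) {c : ℝ} (hc : 0 < c) :
    IsLevyMeasure (ν.map (c • ·)) := by
  have hm : Measurable (fun x : EuclideanSpace ℝ (Fin d) => c • x) := by fun_prop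
  constructor
  · rw [Measure.map_apply hm (measurableSet_singleton _)]
    have : (fun x : EuclideanSpace ℝ (Fin d) => c • x) ⁻¹' {0} = {0} := by
      ext x; simp [hc.ne']
    rw [this, hν.1]
  · rw [lintegral_map (by fun_prop) hm]
    calc ∫⁻ x, ENNReal.ofReal (min (‖c • x‖ ^ 2) 1) ∂ν
        ≤ ∫⁻ x, ENNReal.ofReal (1 + c ^ 2) * ENNReal.ofReal (min (‖x‖ ^ 2) 1) ∂ν := by
          refine lintegral_mono fun x => ?_
          rw [← ENNReal.ofReal_mul (by positivity)]
          refine ENNReal.ofReal_le_ofReal ?_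
          rw [norm_smul, Real.norm_of_nonneg hc.le]
          rcases le_total (‖x‖ ^ 2) 1 with h | h
          · rw [min_eq_left h]
            refine (min_le_left _ _).trans ?_
            nlinarith [sq_nonneg ‖x‖]
          · rw [min_eq_right h]
            refine (min_le_right _ _).trans ?_
            nlinarith [sq_nonneg c]
      _ < ⊤ := by
          rw [lintegral_const_mul _ (by fun_prop)]
          exact ENNReal.mul_lt_top ENNReal.ofReal_lt_top hν.2

/-- Dilating the argument of a Lévy exponent dilates the Lévy measure, up to a drift. -/
theorem IsLevyMeasure.exists_levyExponent_smul_eq (hν : IsLevyMeasure ν) {c : ℝ} (hc : 0 < c) :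
    ∃ δ : EuclideanSpace ℝ (Fin d), ∀ z,
      levyExponent ν (c • z) = levyExponent (ν.map (c • ·)) z + (inner ℝ δ z : ℝ) * Complex.I := by
  have hm : Measurable (fun x : EuclideanSpace ℝ (Fin d) => c • x) := by fun_prop
  -- Truncation at radius 1 does not commute with dilation. `g` records the discrepancy, which
  -- vanishes unless exactly one of `x`, `c • x` lies in the ball; its integral is the drift.
  set g : EuclideanSpace ℝ (Fin d) → EuclideanSpace ℝ (Fin d) := fun x =>
    (Metric.closedBall (0 : EuclideanSpace ℝ (Fin d)) 1).indicator id (c • x)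
      - c • (Metric.closedBall (0 : EuclideanSpace ℝ (Fin d)) 1).indicator id x with hg
  have hgm : Measurable g :=
    ((measurable_id.indicator measurableSet_closedBall).comp hm).sub
      ((measurable_id.indicator measurableSet_closedBall).const_smul c)
  have hgb : ∀ x, ‖g x‖ ≤ (1 + c ^ 2) * min (‖x‖ ^ 2) 1 := by
    intro x
    have hn : ‖c • x‖ = c * ‖x‖ := by rw [norm_smul, Real.norm_of_nonneg hc.le]
    by_cases h1 : ‖c • x‖ ≤ 1 <;> by_cases h2 : ‖x‖ ≤ 1
    · simp only [hg]
      rw [Set.indicator_of_mem (by simpa using h1), Set.indicator_of_mem (by simpa using h2)]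
      simp only [id, sub_self, norm_zero]
      positivity
    · simp only [hg]
      rw [Set.indicator_of_mem (by simpa using h1), Set.indicator_of_notMem (by simpa using h2),
        min_eq_right (by nlinarith [norm_nonneg x])]
      simp only [id, smul_zero, sub_zero]
      nlinarith [sq_nonneg c]
    · simp only [hg]
      rw [Set.indicator_of_notMem (by simpa using h1), Set.indicator_of_mem (by simpa using h2),
        min_eq_left (by nlinarith [norm_nonneg x])]
      simp only [id, zero_sub, norm_neg]
      -- Here `c‖x‖ > 1`, hence `c‖x‖ ≤ c²‖x‖²`.
      rw [hn] at h1 ⊢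
      nlinarith [sq_nonneg ‖x‖]
    · simp only [hg]
      rw [Set.indicator_of_notMem (by simpa using h1), Set.indicator_of_notMem (by simpa using h2)]
      simp only [smul_zero, sub_self, norm_zero]
      positivity
  have hgi : Integrable g ν :=
    (hν.integrable_min.const_mul (1 + c ^ 2)).mono' hgm.aestronglyMeasurable (ae_of_all _ hgb)
  refine ⟨∫ x, g x ∂ν, fun z => ?_⟩
  have hpt : ∀ x, levyKhintchineIntegrand (c • z) x
      = levyKhintchineIntegrand z (c • x) + ((inner ℝ z (g x) : ℝ) : ℂ) * Complex.I := by
    intro x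
    simp only [levyKhintchineIntegrand, hg]
    by_cases h1 : c • x ∈ Metric.closedBall (0 : EuclideanSpace ℝ (Fin d)) 1 <;>
      by_cases h2 : x ∈ Metric.closedBall (0 : EuclideanSpace ℝ (Fin d)) 1 <;>
      simp only [Set.indicator_of_mem, Set.indicator_of_notMem, h1, h2, not_false_eq_true, id,
        inner_sub_right, inner_smul_right, real_inner_smul_left, inner_zero_right] <;>
      push_cast <;> ring
  have hi : Integrable (fun x => levyKhintchineIntegrand z (c • x)) ν :=
    ((hν.map_smul hc).integrable_integrand z).comp_measurable hm
  have hi2 : Integrable (fun x => ((inner ℝ z (g x) : ℝ) : ℂ) * Complex.I) ν :=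
    ((hgi.const_inner z).ofReal).mul_const _
  rw [levyExponent, levyExponent,
    integral_map hm.aemeasurable (measurable_levyKhintchineIntegrand z).aestronglyMeasurable]
  simp_rw [hpt]
  rw [integral_add hi hi2, integral_mul_const, integral_complex_ofReal, integral_inner hgi,
    real_inner_comm]

end Integrand

/-! ### Uniqueness of continuous roots and logarithms. -/

/-- Two continuous functions on a connected space whose `n`-th powers agree and which agree
at a point are equal, for non-vanishing functions. -/
theorem Continuous.eq_of_pow_eq {X : Type*} [TopologicalSpace X] [PreconnectedSpace X]
    {f g : X → ℂ} (hf : Continuous f) (hg : Continuous g) {n : ℕ} (hn : n ≠ 0)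
    (hg0 : ∀ x, g x ≠ 0) (h : ∀ x, f x ^ n = g x ^ n) {x₀ : X} (hx₀ : f x₀ = g x₀) : f = g := by
  have hfin : {w : ℂ | w ^ n = 1}.Finite := by
    have := (Polynomial.nthRootsFinset n (1 : ℂ)).finite_toSet
    refine this.subset fun w hw => ?_
    simpa [Polynomial.mem_nthRootsFinset (Nat.pos_of_ne_zero hn)] using hw
  -- The quotient takes values in the finite set of `n`-th roots of unity, so it is constant on a
  -- connected space.
  have hq : Continuous (fun x => f x / g x) := hf.div hg hg0
  have hsub := hfin.countable.isTotallyDisconnected (Set.range fun x => f x / g x)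
    (by rintro _ ⟨x, rfl⟩; simp [div_pow, h, hg0]) (isPreconnected_range hq)
  funext x
  have := hsub ⟨x, rfl⟩ ⟨x₀, rfl⟩
  simp only [hx₀, div_self (hg0 x₀)] at this
  exact (div_eq_one_iff_eq (hg0 x)).mp this

/-- Continuous logarithms on a connected space are unique. -/
theorem Continuous.eq_of_exp_eq {X : Type*} [TopologicalSpace X] [PreconnectedSpace X]
    {f g : X → ℂ} (hf : Continuous f) (hg : Continuous g)
    (h : ∀ x, Complex.exp (f x) = Complex.exp (g x)) {x₀ : X} (hx₀ : f x₀ = g x₀) : f = g := by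
  have hsub := (Set.countable_range fun n : ℤ => (n : ℂ) * (2 * Real.pi * Complex.I)).isTotallyDisconnected
    (Set.range fun x => f x - g x)
    (by
      rintro _ ⟨x, rfl⟩
      obtain ⟨n, hn⟩ := Complex.exp_eq_exp_iff_exists_int.mp (h x)
      exact ⟨n, by simp [hn]⟩) (isPreconnected_range (hf.sub hg))
  funext x
  have := hsub ⟨x, rfl⟩ ⟨x₀, rfl⟩
  simp only [hx₀, sub_self] at this
  exact sub_eq_zero.mp this

/-! ### Lévy's continuity theorem, existence of the limit law. -/

section LimitOfCharFun

variable {E : Type*} [NormedAddCommGroup E] [InnerProductSpace ℝ E] [FiniteDimensional ℝ E]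
  [MeasurableSpace E] [BorelSpace E]

/-- **Lévy's continuity theorem**, existence part: a pointwise limit of characteristic functions
of probability measures that is continuous at `0` is a characteristic function. -/
theorem exists_isProbabilityMeasure_charFun_eq {μ : ℕ → Measure E}
    [∀ i, IsProbabilityMeasure (μ i)] {f : E → ℂ} (hf : ContinuousAt f 0)
    (h : ∀ t, Tendsto (fun n => charFun (μ n) t) atTop (𝓝 (f t))) :
    ∃ κ : Measure E, IsProbabilityMeasure κ ∧ charFun κ = f := by
  have htight := isTightMeasureSet_of_tendsto_charFun hf h
  let P : ℕ → ProbabilityMeasure E := fun n => ⟨μ n, inferInstance⟩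
  have hcomp : IsCompact (closure (Set.range P)) := by
    refine isCompact_closure_of_isTightMeasureSet ?_
    convert! htight using 1
    ext κ
    simp only [Set.mem_range, Set.mem_ofPred_eq, P]
    exact ⟨fun ⟨_, ⟨n, rfl⟩, h⟩ => ⟨n, h⟩, fun ⟨n, h⟩ => ⟨_, ⟨n, rfl⟩, h⟩⟩
  -- A limit along a free ultrafilter replaces a convergent subsequence: the transforms converge
  -- along `atTop`, so any such limit has transform `f`.
  obtain ⟨κ, -, hκ⟩ := hcomp.ultrafilter_le_nhds ((hyperfilter ℕ).map P)
    (le_principal_iff.2 (mem_map.2 (univ_mem' fun n => subset_closure ⟨n, rfl⟩)))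
  have hκ' : Tendsto P (hyperfilter ℕ) (𝓝 κ) := hκ
  refine ⟨κ, inferInstance, funext fun t => ?_⟩
  rw [ProbabilityMeasure.tendsto_iff_forall_integral_rclike_tendsto ℂ] at hκ'
  have h1 := hκ' (BoundedContinuousFunction.innerProbChar t)
  simp_rw [← charFun_eq_integral_innerProbChar] at h1
  exact tendsto_nhds_unique h1 ((h t).mono_left Nat.hyperfilter_le_atTop)

/-- The existence part of Lévy's continuity theorem for finite measures. -/
theorem exists_isFiniteMeasure_charFun_eq {μ : ℕ → Measure E}
    [∀ i, IsFiniteMeasure (μ i)] {f : E → ℂ} (hf : ContinuousAt f 0)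
    (h : ∀ t, Tendsto (fun n => charFun (μ n) t) atTop (𝓝 (f t))) :
    ∃ κ : Measure E, IsFiniteMeasure κ ∧ charFun κ = f := by
  classical
  have h0 := h 0
  simp only [charFun_zero] at h0
  have hre : Tendsto (fun n => (μ n).real Set.univ) atTop (𝓝 (f 0).re) := by
    exact (Complex.continuous_re.tendsto _).comp h0
  have hre0 : 0 ≤ (f 0).re := ge_of_tendsto' hre fun n => measureReal_nonneg
  have hf0 : f 0 = ((f 0).re : ℂ) :=
    tendsto_nhds_unique h0 ((Complex.continuous_ofReal.tendsto _).comp hre)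
  rcases hre0.eq_or_lt with hz | hpos
  · refine ⟨0, inferInstance, funext fun t => ?_⟩
    rw [charFun_zero_measure]
    refine tendsto_nhds_unique ?_ (h t)
    rw [← hz] at hre
    exact squeeze_zero_norm (fun n => norm_charFun_le t) hre
  · let c : ℕ → ENNReal := fun n => (μ n Set.univ)⁻¹
    let P : ℕ → Measure E := fun n =>
      if μ n = 0 then Measure.dirac 0 else c n • μ n
    have hP : ∀ n, IsProbabilityMeasure (P n) := by
      intro n
      by_cases hn : μ n = 0
      · simp only [P, hn, if_true]; infer_instance
      · simp only [P, hn, if_false]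
        have : NeZero (μ n) := ⟨hn⟩
        exact isProbabilityMeasureSMul
    obtain ⟨κ, hκ, hκf⟩ := exists_isProbabilityMeasure_charFun_eq (μ := P)
      (f := fun t => ((f 0).re : ℂ)⁻¹ * f t) (by fun_prop) (by
        intro t
        have hinv : Tendsto (fun n => (((μ n).real Set.univ : ℝ) : ℂ)⁻¹) atTop
            (𝓝 ((f 0).re : ℂ)⁻¹) :=
          ((Complex.continuous_ofReal.tendsto _).comp hre).inv₀ (by exact_mod_cast hpos.ne')
        refine (hinv.mul (h t)).congr' ?_
        filter_upwards [hre.eventually (lt_mem_nhds hpos)] with n hn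
        have hn0 : μ n ≠ 0 := by
          rintro h0
          simp [h0] at hn
        simp only [P, hn0, if_false, c, charFun_apply, integral_smul_measure, ENNReal.toReal_inv]
        rw [Complex.real_smul, Complex.ofReal_inv]
        rfl)
    refine ⟨ENNReal.ofReal (f 0).re • κ, ?_, funext fun t => ?_⟩
    · exact κ.smul_finite ENNReal.ofReal_ne_top
    · have := congrFun hκf t
      rw [charFun_apply, integral_smul_measure, ← charFun_apply, this, ENNReal.toReal_ofReal hre0,
        Complex.real_smul, mul_inv_cancel_left₀ (by exact_mod_cast hpos.ne')]

end LimitOfCharFun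

/-! ### Laws with a given Lévy measure and drift. -/

section Construction

variable {d : ℕ}

instance isProbabilityMeasure_convPower (ρ : Measure (EuclideanSpace ℝ (Fin d)))
    [IsProbabilityMeasure ρ] (n : ℕ) : IsProbabilityMeasure (convPower ρ n) := by
  induction n with
  | zero => exact Measure.dirac.isProbabilityMeasure
  | succ n ih => 
    unfold convPower
    infer_instance

theorem charFun_convPower (ρ : Measure (EuclideanSpace ℝ (Fin d))) [IsProbabilityMeasure ρ]
    (n : ℕ) (z : EuclideanSpace ℝ (Fin d)) : charFun (convPower ρ n) z = charFun ρ z ^ n := by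
  induction n with
  | zero => simp [convPower]
  | succ n ih =>
    unfold convPower
    rw [charFun_conv, ih, pow_succ]

/-- The compound Poisson distribution with finite jump measure `ν`. -/
theorem exists_compoundPoisson (ν : Measure (EuclideanSpace ℝ (Fin d))) [IsFiniteMeasure ν] :
    ∃ κ : Measure (EuclideanSpace ℝ (Fin d)), IsProbabilityMeasure κ ∧
      ∀ z, charFun κ z = Complex.exp (charFun ν z - ν.real Set.univ) := by
  set c : ℝ := ν.real Set.univ with hc
  have hc0 : 0 ≤ c := measureReal_nonneg
  -- After normalisation the transform is `1 + (ν̂ - c)/(n+1+c)`, whose `n`-th power tends to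
  -- `exp(ν̂ - c)`. The weight `n + 1` keeps the mass positive even when `n = 0` and `ν = 0`.
  let τ : ℕ → Measure (EuclideanSpace ℝ (Fin d)) := fun n =>
    ((n + 1 : ℕ) : ENNReal) • Measure.dirac 0 + ν
  have hτ : ∀ n, τ n Set.univ = ((n + 1 : ℕ) : ENNReal) + ν Set.univ := by
    intro n; simp [τ]
  have hτf : ∀ n, IsFiniteMeasure (τ n) := fun n => ⟨by
    rw [hτ]; exact ENNReal.add_lt_top.2 ⟨ENNReal.natCast_lt_top _, measure_lt_top _ _⟩⟩
  have hτ0 : ∀ n, NeZero (τ n) := fun n => ⟨fun h => by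
    have := hτ n
    rw [h] at this
    simp only [Measure.coe_zero, Pi.zero_apply] at this
    have h2 := (add_eq_zero.1 this.symm).1
    exact absurd (Nat.cast_eq_zero.1 h2) (by omega)⟩
  let ρ : ℕ → Measure (EuclideanSpace ℝ (Fin d)) := fun n => (τ n Set.univ)⁻¹ • τ n
  have hρ : ∀ n, IsProbabilityMeasure (ρ n) := fun n => isProbabilityMeasureSMul
  have hρc : ∀ n z, charFun (ρ n) z = 1 + (charFun ν z - c) / ((n : ℂ) + 1 + c) := by
    intro n z
    have h1 : charFun (τ n) z = (n : ℂ) + 1 + charFun ν z := by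
      rw [charFun_apply, integral_add_measure, integral_smul_measure, ← charFun_apply,
        ← charFun_apply, charFun_dirac]
      · rw [ENNReal.toReal_natCast]
        simp [Complex.real_smul]
      · refine Integrable.smul_measure ?_ (ENNReal.natCast_ne_top _)
        exact (integrable_const (1 : ℝ)).mono (by fun_prop) (by simp)
      · exact (integrable_const (1 : ℝ)).mono (by fun_prop) (by simp)
    have h2 : (τ n Set.univ).toReal = n + 1 + c := by
      rw [hτ, ENNReal.toReal_add (ENNReal.natCast_ne_top _) (measure_ne_top _ _),
        ENNReal.toReal_natCast, hc, Measure.real]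
      push_cast
      ring
    have h3 : ((n : ℂ) + 1 + c) ≠ 0 := by
      have : (0 : ℝ) < n + 1 + c := by positivity
      exact_mod_cast this.ne'
    rw [charFun_apply, integral_smul_measure, ← charFun_apply, h1, ENNReal.toReal_inv, h2,
      Complex.real_smul]
    push_cast
    field_simp
    ring
  obtain ⟨κ, hκ, hκf⟩ := exists_isProbabilityMeasure_charFun_eq
    (μ := fun n => convPower (ρ n) n) (f := fun z => Complex.exp (charFun ν z - c))
    (by have : Continuous (charFun ν) := continuous_charFun
        fun_prop) (by
      intro z
      simp_rw [charFun_convPower, hρc]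
      refine Complex.tendsto_one_add_pow_exp_of_tendsto ?_
      have hlim : Tendsto (fun n : ℕ => ((n : ℝ) / (n + (1 + c)) : ℝ)) atTop (𝓝 1) :=
        tendsto_natCast_div_add_atTop (1 + c)
      have := ((Complex.continuous_ofReal.tendsto _).comp hlim).mul_const (charFun ν z - c)
      rw [Complex.ofReal_one, one_mul] at this
      refine this.congr fun n => ?_
      simp only [Function.comp]
      push_cast
      rw [add_assoc]
      ring)
  exact ⟨κ, hκ, congrFun hκf⟩

variable {ν : Measure (EuclideanSpace ℝ (Fin d))}

theorem IsLevyMeasure.measure_norm_gt_lt_top (hν : IsLevyMeasure ν) {r : ℝ} (hr : 0 < r) :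
    ν {x | r < ‖x‖} < ⊤ := by
  have h := hν.integrable_min.measure_ge_lt_top (ε := min (r ^ 2) 1) (by positivity)
  refine (measure_mono fun x hx => ?_).trans_lt h
  have hx' : r < ‖x‖ := hx
  exact min_le_min (pow_le_pow_left₀ hr.le hx'.le 2) le_rfl

/-- Existence of a probability measure with prescribed Lévy measure and drift. -/
theorem IsLevyMeasure.exists_charFun_eq (hν : IsLevyMeasure ν) (γ : EuclideanSpace ℝ (Fin d)) :
    ∃ κ : Measure (EuclideanSpace ℝ (Fin d)), IsProbabilityMeasure κ ∧
      ∀ z, charFun κ z = Complex.exp (levyExponent ν z + (inner ℝ γ z : ℝ) * Complex.I) := by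
  -- Jumps larger than `1/(n+1)` have finite total mass, so each truncation is compound Poisson.
  let s : ℕ → Set (EuclideanSpace ℝ (Fin d)) := fun n => {x | 1 / ((n : ℝ) + 1) < ‖x‖}
  have hs : ∀ n, MeasurableSet (s n) := fun n => measurableSet_lt (by fun_prop) (by fun_prop)
  have hfin : ∀ n, IsFiniteMeasure (ν.restrict (s n)) := fun n => ⟨by
    rw [Measure.restrict_apply_univ]
    exact hν.measure_norm_gt_lt_top (by positivity)⟩
  have hstep : ∀ n, ∃ κ : Measure (EuclideanSpace ℝ (Fin d)), IsProbabilityMeasure κ ∧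
      ∀ z, charFun κ z =
        Complex.exp (levyExponent (ν.restrict (s n)) z + (inner ℝ γ z : ℝ) * Complex.I) := by
    intro n
    obtain ⟨κ, hκ, hκf⟩ := exists_compoundPoisson (ν.restrict (s n))
    set g : EuclideanSpace ℝ (Fin d) → EuclideanSpace ℝ (Fin d) :=
      (Metric.closedBall (0 : EuclideanSpace ℝ (Fin d)) 1).indicator id with hg
    have hgi : Integrable g (ν.restrict (s n)) := by
      refine (integrable_const (1 : ℝ)).mono'
        (measurable_id.indicator measurableSet_closedBall).aestronglyMeasurable
        (ae_of_all _ fun x => ?_)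
      by_cases hx : ‖x‖ ≤ 1
      · rw [hg, Set.indicator_of_mem (by simpa using hx)]; exact hx
      · rw [hg, Set.indicator_of_notMem (by simpa using hx)]; simp
    -- The compound Poisson exponent is uncompensated; the shift supplies the compensator together
    -- with the drift.
    let γ' := γ - ∫ x, g x ∂(ν.restrict (s n))
    refine ⟨κ.conv (Measure.dirac γ'), inferInstance, fun z => ?_⟩
    rw [charFun_conv, charFun_dirac, hκf, ← Complex.exp_add]
    congr 1
    have hi1 : Integrable (fun x => Complex.exp ((inner ℝ z x : ℝ) * Complex.I))
        (ν.restrict (s n)) := (integrable_const (1 : ℝ)).mono (by fun_prop) (by simp)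
    have hi2 : Integrable (fun x => ((inner ℝ z (g x) : ℝ) : ℂ) * Complex.I)
        (ν.restrict (s n)) := ((hgi.const_inner z).ofReal).mul_const _
    have hpt : ∀ x, levyKhintchineIntegrand z x = Complex.exp ((inner ℝ z x : ℝ) * Complex.I) - 1
        - ((inner ℝ z (g x) : ℝ) : ℂ) * Complex.I := by
      intro x
      simp only [levyKhintchineIntegrand, hg]
      by_cases hx : x ∈ Metric.closedBall (0 : EuclideanSpace ℝ (Fin d)) 1 <;>
        simp [Set.indicator_of_mem, Set.indicator_of_notMem, hx]
    rw [levyExponent]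
    simp_rw [hpt]
    have hi3 : Integrable (fun x => Complex.exp ((inner ℝ z x : ℝ) * Complex.I) - 1)
        (ν.restrict (s n)) := hi1.sub (integrable_const _)
    rw [integral_sub hi3 hi2, integral_sub hi1 (integrable_const _),
      integral_mul_const, integral_complex_ofReal, integral_inner hgi, charFun_apply]
    simp only [γ', inner_sub_left, integral_const, real_inner_comm,
      Complex.real_smul, mul_one, Complex.ofReal_sub]
    rw [real_inner_comm z]
    ring
  choose κ hκ hκf using hstep
  obtain ⟨P, hP, hPf⟩ := exists_isProbabilityMeasure_charFun_eq (μ := κ)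
    (f := fun z => Complex.exp (levyExponent ν z + (inner ℝ γ z : ℝ) * Complex.I))
    (by have := hν.continuous_levyExponent
        fun_prop) (by
      intro z
      simp_rw [hκf]
      refine (Complex.continuous_exp.tendsto _).comp (Tendsto.add_const _ ?_)
      have hU : ⋃ n, s n = {0}ᶜ := by
        ext x
        simp only [s, Set.mem_iUnion, Set.mem_ofPred_eq, Set.mem_compl_iff, Set.mem_singleton_iff]
        constructor
        · rintro ⟨n, hn⟩ rfl
          rw [norm_zero] at hn
          have : (0 : ℝ) < 1 / ((n : ℝ) + 1) := by positivity
          linarith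
        · intro hx
          exact exists_nat_one_div_lt (norm_pos_iff.2 hx)
      have hmono : Monotone s := by
        intro m n hmn x (hx : 1 / ((m : ℝ) + 1) < ‖x‖)
        exact lt_of_le_of_lt (one_div_le_one_div_of_le (by positivity) (by gcongr)) hx
      have h0 : ν.restrict {0}ᶜ = ν := by
        refine Measure.restrict_eq_self_of_ae_mem ?_
        rw [ae_iff]
        simpa using hν.1
      have := tendsto_setIntegral_of_monotone hs hmono
        (hν.integrable_integrand z).integrableOn
      rwa [hU, h0] at this)
  exact ⟨P, hP, congrFun hPf⟩

theorem hasLevyTriplet_zero_iff {μ : Measure (EuclideanSpace ℝ (Fin d))}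
    {γ : EuclideanSpace ℝ (Fin d)} :
    HasLevyTriplet μ 0 ν γ ↔ IsLevyMeasure ν ∧
      ∀ z, charFun μ z = Complex.exp (levyExponent ν z + (inner ℝ γ z : ℝ) * Complex.I) := by
  constructor
  · intro h
    refine ⟨h.levyMeasure, fun z => ?_⟩
    rw [h.charFun_eq z]
    simp [levyExponent]
  · rintro ⟨h, h'⟩
    refine ⟨Matrix.PosSemidef.zero, h, fun z => ?_⟩
    rw [h' z]
    simp [levyExponent]

/-- A probability measure with a Gaussian-free Lévy–Khintchine representation is infinitely
divisible. -/
theorem HasLevyTriplet.isInfinitelyDivisible {μ : Measure (EuclideanSpace ℝ (Fin d))}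
    [IsProbabilityMeasure μ] {γ : EuclideanSpace ℝ (Fin d)} (h : HasLevyTriplet μ 0 ν γ) :
    IsInfinitelyDivisible μ := by
  obtain ⟨hν, hμ⟩ := hasLevyTriplet_zero_iff.1 h
  refine ⟨inferInstance, fun n hn => ?_⟩
  have hn0 : (n : ℂ) ≠ 0 := by exact_mod_cast (by omega : n ≠ 0)
  -- The `n`-th root has Lévy measure `ν/n` and drift `γ/n`.
  obtain ⟨ρ, hρ, hρf⟩ := (hν.smul (c := ENNReal.ofReal (n : ℝ)⁻¹)
    ENNReal.ofReal_ne_top).exists_charFun_eq ((n : ℝ)⁻¹ • γ)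
  refine ⟨ρ, hρ, Measure.ext_of_charFun (funext fun z => ?_)⟩
  rw [charFun_convPower, hρf, ← Complex.exp_nat_mul, hμ, levyExponent_smul (by positivity),
    real_inner_smul_left]
  congr 1
  push_cast
  field_simp

theorem IsLevyMeasure.exists_hasLevyTriplet (hν : IsLevyMeasure ν)
    (γ : EuclideanSpace ℝ (Fin d)) :
    ∃ μ : Measure (EuclideanSpace ℝ (Fin d)),
      IsInfinitelyDivisible μ ∧ HasLevyTriplet μ 0 ν γ := by
  obtain ⟨μ, hμ, h⟩ := hν.exists_charFun_eq γ
  have ht := hasLevyTriplet_zero_iff.2 ⟨hν, h⟩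
  exact ⟨μ, ht.isInfinitelyDivisible, ht⟩

end Construction

/-! ### Recovering a Lévy measure from its exponent. -/

section CosDamped

variable {d : ℕ}

/-- The measure `(1 - cos ⟨w, x⟩) ν(dx)`. -/
noncomputable def cosDamped (w : EuclideanSpace ℝ (Fin d))
    (ν : Measure (EuclideanSpace ℝ (Fin d))) : Measure (EuclideanSpace ℝ (Fin d)) :=
  ν.withDensity fun x => ENNReal.ofReal (1 - Real.cos (inner ℝ w x))

variable {ν ν₁ ν₂ ρ : Measure (EuclideanSpace ℝ (Fin d))}

/-- The density is quadratically small at the origin and at most 2 everywhere. -/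
theorem IsLevyMeasure.isFiniteMeasure_cosDamped (hν : IsLevyMeasure ν)
    (w : EuclideanSpace ℝ (Fin d)) : IsFiniteMeasure (cosDamped w ν) := by
  refine isFiniteMeasure_withDensity (ne_of_lt ?_)
  calc ∫⁻ x, ENNReal.ofReal (1 - Real.cos (inner ℝ w x)) ∂ν
      ≤ ∫⁻ x, ENNReal.ofReal (‖w‖ ^ 2 + 2) * ENNReal.ofReal (min (‖x‖ ^ 2) 1) ∂ν := by
        refine lintegral_mono fun x => ?_
        rw [← ENNReal.ofReal_mul (by positivity)]
        refine ENNReal.ofReal_le_ofReal ?_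
        rcases le_total (‖x‖ ^ 2) 1 with h | h
        · rw [min_eq_left h]
          have h1 := Real.one_sub_sq_div_two_le_cos (x := inner ℝ w x)
          have h2 : (inner ℝ w x) ^ 2 ≤ (‖w‖ * ‖x‖) ^ 2 :=
            sq_le_sq' (by linarith [neg_abs_le (inner ℝ w x), abs_real_inner_le_norm w x])
              ((le_abs_self _).trans (abs_real_inner_le_norm w x))
          nlinarith [sq_nonneg ‖x‖, sq_nonneg (‖w‖ * ‖x‖)]
        · rw [min_eq_right h]
          nlinarith [Real.neg_one_le_cos (inner ℝ w x), sq_nonneg ‖w‖]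
    _ < ⊤ := by
        rw [lintegral_const_mul _ (by fun_prop)]
        exact ENNReal.mul_lt_top ENNReal.ofReal_lt_top hν.2

theorem charFun_cosDamped_eq_integral (w z : EuclideanSpace ℝ (Fin d)) :
    charFun (cosDamped w ν) z = ∫ x, ((1 - Real.cos (inner ℝ w x) : ℝ) : ℂ) *
      Complex.exp ((inner ℝ x z : ℝ) * Complex.I) ∂ν := by
  rw [charFun_apply, cosDamped, integral_withDensity_eq_integral_toReal_smul (by fun_prop)
    (ae_of_all _ fun x => ENNReal.ofReal_lt_top)]
  refine integral_congr_ae (ae_of_all _ fun x => ?_)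
  simp only
  rw [ENNReal.toReal_ofReal (by linarith [Real.cos_le_one (inner ℝ w x)]), Complex.real_smul]

theorem one_sub_cos_mul_exp (u v : ℝ) :
    ((1 - Real.cos u : ℝ) : ℂ) * Complex.exp (v * Complex.I) =
      Complex.exp (v * Complex.I) - (Complex.exp (((v + u : ℝ) : ℂ) * Complex.I)
        + Complex.exp (((v - u : ℝ) : ℂ) * Complex.I)) / 2 := by
  push_cast
  rw [Complex.cos, add_mul, sub_eq_add_neg (v : ℂ), add_mul, Complex.exp_add, Complex.exp_add]
  ring

/-- Multiplying `e^{i⟨z,x⟩}` by `1 - cos⟨w,x⟩` is a second difference in `z`, which annihilates the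
`-1` and the compensator, an affine function of `z`. -/
theorem IsLevyMeasure.charFun_cosDamped (hν : IsLevyMeasure ν)
    (w z : EuclideanSpace ℝ (Fin d)) :
    charFun (cosDamped w ν) z =
      levyExponent ν z - (levyExponent ν (z + w) + levyExponent ν (z - w)) / 2 := by
  have hi : Integrable (fun x => (levyKhintchineIntegrand (z + w) x
      + levyKhintchineIntegrand (z - w) x) / 2) ν :=
    ((hν.integrable_integrand _).add (hν.integrable_integrand _)).div_const 2
  rw [charFun_cosDamped_eq_integral, levyExponent, levyExponent, levyExponent,
    ← integral_add (hν.integrable_integrand _) (hν.integrable_integrand _), ← integral_div,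
    ← integral_sub (hν.integrable_integrand _) hi]
  refine integral_congr_ae (ae_of_all _ fun x => ?_)
  simp only
  rw [one_sub_cos_mul_exp, real_inner_comm z x, ← inner_add_left, ← inner_sub_left]
  simp only [levyKhintchineIntegrand]
  by_cases hx : x ∈ Metric.closedBall (0 : EuclideanSpace ℝ (Fin d)) 1 <;>
    simp only [Set.indicator_of_mem, Set.indicator_of_notMem, hx, not_false_eq_true,
      inner_add_left, inner_sub_left] <;> push_cast <;> ring

theorem charFun_cosDamped_of_isFiniteMeasure [IsFiniteMeasure ρ]
    (w z : EuclideanSpace ℝ (Fin d)) :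
    charFun (cosDamped w ρ) z =
      charFun ρ z - (charFun ρ (z + w) + charFun ρ (z - w)) / 2 := by
  have hi : ∀ z : EuclideanSpace ℝ (Fin d),
      Integrable (fun x => Complex.exp ((inner ℝ x z : ℝ) * Complex.I)) ρ := fun z =>
    (integrable_const (1 : ℝ)).mono (by fun_prop) (by simp)
  have hi2 : Integrable (fun x => (Complex.exp ((inner ℝ x (z + w) : ℝ) * Complex.I)
      + Complex.exp ((inner ℝ x (z - w) : ℝ) * Complex.I)) / 2) ρ :=
    ((hi _).add (hi _)).div_const 2
  rw [charFun_cosDamped_eq_integral, charFun_apply, charFun_apply, charFun_apply,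
    ← integral_add (hi _) (hi _), ← integral_div, ← integral_sub (hi _) hi2]
  refine integral_congr_ae (ae_of_all _ fun x => ?_)
  simp only
  rw [one_sub_cos_mul_exp, real_inner_comm x w, ← inner_add_right, ← inner_sub_right]

/-- The condition on `w` is open, and `w = πx/|x|²` satisfies it with cosine `-1`. Thus countably
many dampings see every nonzero point. -/
theorem exists_cos_inner_denseSeq_ne_one {x : EuclideanSpace ℝ (Fin d)} (hx : x ≠ 0) :
    ∃ n, Real.cos (inner ℝ (TopologicalSpace.denseSeq (EuclideanSpace ℝ (Fin d)) n) x) ≠ 1 := by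
  refine (TopologicalSpace.denseRange_denseSeq (EuclideanSpace ℝ (Fin d))).exists_mem_open
    (s := {w | Real.cos (inner ℝ w x) ≠ 1}) ?_ ?_
  · exact isOpen_ne_fun (by fun_prop) continuous_const
  · refine ⟨(Real.pi / ‖x‖ ^ 2) • x, ?_⟩
    have : ‖x‖ ≠ 0 := norm_ne_zero_iff.2 hx
    simp only [Set.mem_ofPred_eq, real_inner_smul_left, real_inner_self_eq_norm_sq]
    rw [div_mul_cancel₀ _ (by positivity), Real.cos_pi]
    norm_num

/-- Away from the origin, a measure is controlled by its damped versions. -/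
theorem le_of_forall_cosDamped_le (h₂ : ν₂ {0} = 0)
    (h : ∀ w, cosDamped w ν₂ ≤ cosDamped w ν₁) : ν₂ ≤ ν₁ := by
  let f : ℕ → EuclideanSpace ℝ (Fin d) → ENNReal := fun n x => ENNReal.ofReal
    (1 - Real.cos (inner ℝ (TopologicalSpace.denseSeq (EuclideanSpace ℝ (Fin d)) n) x))
  have hf : ∀ n, Measurable (f n) := fun n => by fun_prop
  let s : ℕ → Set (EuclideanSpace ℝ (Fin d)) := fun n => {x | f n x ≠ 0}
  have hs : ∀ n, MeasurableSet (s n) := fun n => (hf n) (measurableSet_singleton 0).compl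
  have hle : ∀ n, ν₂.restrict (s n) ≤ ν₁.restrict (s n) := by
    intro n
    -- On `s n` the damping density is positive and finite, so it can be divided out.
    have key : ∀ ν : Measure (EuclideanSpace ℝ (Fin d)), ν.restrict (s n)
        = ((ν.withDensity (f n)).restrict (s n)).withDensity (fun x => (f n x)⁻¹) := by
      intro ν
      rw [restrict_withDensity (hs n), withDensity_inv_same (hf n)]
      · exact (ae_restrict_iff' (hs n)).2 (ae_of_all _ fun x hx => hx)
      · exact ae_of_all _ fun x => ENNReal.ofReal_ne_top
    rw [key ν₁, key ν₂]
    refine Measure.le_iff.2 fun B hB => ?_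
    rw [withDensity_apply _ hB, withDensity_apply _ hB]
    exact lintegral_mono' (Measure.restrict_mono_measure (Measure.restrict_mono_measure (h _) _) _)
      le_rfl
  refine Measure.le_iff.2 fun B hB => ?_
  have hU : ⋃ n, disjointed s n = {0}ᶜ := by
    rw [iUnion_disjointed]
    ext x
    simp only [Set.mem_iUnion, Set.mem_compl_iff, Set.mem_singleton_iff, s, f, Set.mem_ofPred_eq,
      ne_eq, ENNReal.ofReal_eq_zero, not_le]
    constructor
    · rintro ⟨n, hn⟩ rfl
      simp at hn
    · intro hx
      obtain ⟨n, hn⟩ := exists_cos_inner_denseSeq_ne_one hx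
      exact ⟨n, by linarith [lt_of_le_of_ne (Real.cos_le_one _) hn]⟩
  have hd := fun n => MeasurableSet.disjointed hs n
  calc ν₂ B ≤ ν₂ (B ∩ {0}ᶜ) + ν₂ {0} := by
        refine (measure_mono fun x hx => ?_).trans (measure_union_le _ _)
        by_cases h0 : x = 0 <;> simp [hx, h0]
    _ = ∑' n, ν₂ (B ∩ disjointed s n) := by
        rw [h₂, add_zero, ← hU, Set.inter_iUnion, measure_iUnion _ fun n => hB.inter (hd n)]
        exact fun i j hij => (disjoint_disjointed s hij).mono Set.inter_subset_right
          Set.inter_subset_right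
    _ ≤ ∑' n, ν₁ (B ∩ disjointed s n) := by
        refine ENNReal.tsum_le_tsum fun n => ?_
        have := hle n (B ∩ disjointed s n)
        rwa [Measure.restrict_eq_self _ (Set.inter_subset_right.trans (disjointed_subset s n)),
          Measure.restrict_eq_self _ (Set.inter_subset_right.trans (disjointed_subset s n))] at this
    _ = ν₁ (⋃ n, B ∩ disjointed s n) := by
        rw [measure_iUnion _ fun n => hB.inter (hd n)]
        exact fun i j hij => (disjoint_disjointed s hij).mono Set.inter_subset_right
          Set.inter_subset_right
    _ ≤ ν₁ B := measure_mono (Set.iUnion_subset fun n => Set.inter_subset_left)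

theorem Complex.tendsto_nat_succ_mul_exp_div_sub_one (a : ℂ) :
    Tendsto (fun n : ℕ => ((n + 1 : ℕ) : ℂ) * (Complex.exp (a / ((n + 1 : ℕ) : ℂ)) - 1)) atTop
      (𝓝 a) := by
  have hd : HasDerivAt (fun t : ℂ => Complex.exp (a * t)) a 0 := by
    have := ((hasDerivAt_id (0 : ℂ)).const_mul a).cexp
    simpa using this
  have ht : Tendsto (fun n : ℕ => (((n + 1 : ℕ) : ℂ))⁻¹) atTop (𝓝[≠] 0) := by
    refine tendsto_nhdsWithin_iff.2 ⟨?_, .of_forall fun n => ?_⟩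
    · exact (tendsto_inv_atTop_nhds_zero_nat (𝕜 := ℂ)).comp (tendsto_add_atTop_nat 1)
    · simp only [Set.mem_compl_iff, Set.mem_singleton_iff, inv_eq_zero]
      exact_mod_cast n.succ_ne_zero
  refine (hd.tendsto_slope_zero.comp ht).congr fun n => ?_
  simp [div_eq_mul_inv]

/-- If an infinitely divisible distribution has a quasi-Lévy exponent given by the difference of
two Lévy measures, then this difference is nonnegative. -/
theorem IsInfinitelyDivisible.levyMeasure_le (hρ : IsInfinitelyDivisible ρ)
    (h₁ : IsLevyMeasure ν₁) (h₂ : IsLevyMeasure ν₂) {γ : EuclideanSpace ℝ (Fin d)}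
    (h : ∀ z, charFun ρ z = Complex.exp
      (levyExponent ν₁ z - levyExponent ν₂ z + (inner ℝ γ z : ℝ) * Complex.I)) : ν₂ ≤ ν₁ := by
  set φ : EuclideanSpace ℝ (Fin d) → ℂ := fun z =>
    levyExponent ν₁ z - levyExponent ν₂ z + (inner ℝ γ z : ℝ) * Complex.I with hφ
  have hφc : Continuous φ := by
    have := h₁.continuous_levyExponent
    have := h₂.continuous_levyExponent
    fun_prop
  have hφ0 : φ 0 = 0 := by simp [hφ]
  obtain ⟨-, hroot⟩ := hρ
  choose κ hκ hκp using fun n : ℕ => hroot (n + 1) (by omega)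
  -- Both sides are continuous, equal 1 at the origin and have the same `(n+1)`-st power, so no
  -- branch has to be chosen.
  have hκf : ∀ n z, charFun (κ n) z = Complex.exp (φ z / ((n + 1 : ℕ) : ℂ)) := by
    intro n
    refine congrFun (Continuous.eq_of_pow_eq (n := n + 1) (x₀ := 0) continuous_charFun
      (by fun_prop) (by omega) (fun z => Complex.exp_ne_zero _) (fun z => ?_) ?_)
    · rw [← charFun_convPower, hκp, h, ← Complex.exp_nat_mul, mul_div_cancel₀]
      exact_mod_cast n.succ_ne_zero
    · simp [hφ0]
  refine le_of_forall_cosDamped_le h₂.1 fun w => ?_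
  have := h₁.isFiniteMeasure_cosDamped w
  have := h₂.isFiniteMeasure_cosDamped w
  -- `(n+1)(κ̂ₙ - 1) → φ`, and second differences ignore the `-1`; hence the transforms of `m n`
  -- converge.
  let m : ℕ → Measure (EuclideanSpace ℝ (Fin d)) := fun n =>
    ((n + 1 : ℕ) : ENNReal) • cosDamped w (κ n)
  have hκd : ∀ n, IsFiniteMeasure (cosDamped w (κ n)) := fun n =>
    isFiniteMeasure_withDensity_ofReal
      ((integrable_const (1 : ℝ)).sub
        ((integrable_const (1 : ℝ)).mono (by fun_prop) (by simp [Real.abs_cos_le_one]))).2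
  have hm : ∀ n, IsFiniteMeasure (m n) := fun n =>
    Measure.smul_finite _ (ENNReal.natCast_ne_top _)
  obtain ⟨τ, hτ, hτf⟩ := exists_isFiniteMeasure_charFun_eq (μ := m)
    (f := fun z => charFun (cosDamped w ν₁) z - charFun (cosDamped w ν₂) z)
    (by have h1 : Continuous (charFun (cosDamped w ν₁)) := continuous_charFun
        have h2 : Continuous (charFun (cosDamped w ν₂)) := continuous_charFun
        fun_prop) (by
      intro z
      have hlim : charFun (cosDamped w ν₁) z - charFun (cosDamped w ν₂) z
          = φ z - (φ (z + w) + φ (z - w)) / 2 := by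
        rw [h₁.charFun_cosDamped, h₂.charFun_cosDamped]
        simp only [hφ, inner_add_right, inner_sub_right]
        push_cast
        ring
      rw [hlim]
      refine ((Complex.tendsto_nat_succ_mul_exp_div_sub_one (φ z)).sub
        (((Complex.tendsto_nat_succ_mul_exp_div_sub_one (φ (z + w))).add
          (Complex.tendsto_nat_succ_mul_exp_div_sub_one (φ (z - w)))).div_const 2)).congr
        fun n => ?_
      simp only [m]
      rw [charFun_apply, integral_smul_measure, ← charFun_apply,
        charFun_cosDamped_of_isFiniteMeasure, hκf, hκf, hκf, ENNReal.toReal_natCast,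
        Complex.real_smul]
      push_cast
      ring)
  have hsum : cosDamped w ν₁ = τ + cosDamped w ν₂ := by
    refine Measure.ext_of_charFun (funext fun z => ?_)
    have hi : ∀ (κ : Measure (EuclideanSpace ℝ (Fin d))) [IsFiniteMeasure κ],
        Integrable (fun x => Complex.exp ((inner ℝ x z : ℝ) * Complex.I)) κ := fun κ _ =>
      (integrable_const (1 : ℝ)).mono (by fun_prop) (by simp)
    rw [charFun_apply (μ := τ + _), integral_add_measure (hi _) (hi _), ← charFun_apply,
      ← charFun_apply, hτf]
    simp
  rw [hsum]
  exact Measure.le_add_left le_rfl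

/-- Uniqueness of the Lévy measure and the drift of a distribution without Gaussian part. -/
theorem HasLevyTriplet.unique {μ : Measure (EuclideanSpace ℝ (Fin d))}
    {γ₁ γ₂ : EuclideanSpace ℝ (Fin d)} (h₁ : HasLevyTriplet μ 0 ν₁ γ₁)
    (h₂ : HasLevyTriplet μ 0 ν₂ γ₂) : ν₁ = ν₂ ∧ γ₁ = γ₂ := by
  have key : ∀ {ν₁ ν₂ : Measure (EuclideanSpace ℝ (Fin d))} {γ₁ γ₂ : EuclideanSpace ℝ (Fin d)},
      HasLevyTriplet μ 0 ν₁ γ₁ → HasLevyTriplet μ 0 ν₂ γ₂ → ν₂ ≤ ν₁ := by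
    intro ν₁ ν₂ γ₁ γ₂ h₁ h₂
    obtain ⟨hν₁, hf₁⟩ := hasLevyTriplet_zero_iff.1 h₁
    obtain ⟨hν₂, hf₂⟩ := hasLevyTriplet_zero_iff.1 h₂
    have hδ : IsInfinitelyDivisible (Measure.dirac (0 : EuclideanSpace ℝ (Fin d))) := by
      refine ⟨inferInstance, fun n _ => ⟨Measure.dirac 0, inferInstance,
        Measure.ext_of_charFun (funext fun z => ?_)⟩⟩
      simp [charFun_convPower]
    -- The quotient of the two representations of `μ̂` is the constant 1, the transform of `δ₀`.
    refine hδ.levyMeasure_le hν₁ hν₂ (γ := γ₁ - γ₂) fun z => ?_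
    rw [charFun_dirac, inner_zero_left, Complex.ofReal_zero, zero_mul, Complex.exp_zero,
      show levyExponent ν₁ z - levyExponent ν₂ z + (inner ℝ (γ₁ - γ₂) z : ℝ) * Complex.I
        = (levyExponent ν₁ z + (inner ℝ γ₁ z : ℝ) * Complex.I)
          - (levyExponent ν₂ z + (inner ℝ γ₂ z : ℝ) * Complex.I) by
        rw [inner_sub_left]; push_cast; ring,
      Complex.exp_sub, ← hf₁, hf₂, div_self (Complex.exp_ne_zero _)]
  have hν : ν₁ = ν₂ := le_antisymm (key h₂ h₁) (key h₁ h₂)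
  refine ⟨hν, ?_⟩
  subst hν
  have hd : Measure.dirac γ₁ = Measure.dirac γ₂ := by
    refine Measure.ext_of_charFun (funext fun z => ?_)
    have e := ((hasLevyTriplet_zero_iff.1 h₁).2 z).symm.trans ((hasLevyTriplet_zero_iff.1 h₂).2 z)
    rw [Complex.exp_add, Complex.exp_add] at e
    rw [charFun_dirac, charFun_dirac]
    exact mul_left_cancel₀ (Complex.exp_ne_zero _) e
  exact dirac_eq_dirac_iff.1 hd

end CosDamped

/-! ### Selfdecomposability as domination of dilated Lévy measures. -/

section Scaling

variable {d : ℕ} {ν ν₁ ν₂ μ : Measure (EuclideanSpace ℝ (Fin d))}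
  {γ : EuclideanSpace ℝ (Fin d)}

theorem IsLevyMeasure.sigmaFinite (hν : IsLevyMeasure ν) : SigmaFinite ν := by
  refine Measure.sigmaFinite_of_countable
    (S := insert {0} (Set.range fun n : ℕ => {x | 1 / ((n : ℝ) + 1) < ‖x‖}))
    ((Set.countable_range _).insert _) ?_ (Set.eq_univ_of_forall fun x => ?_)
  · rintro _ (rfl | ⟨n, rfl⟩)
    · rw [hν.1]
      exact ENNReal.zero_lt_top
    · exact hν.measure_norm_gt_lt_top (by positivity)
  · rcases eq_or_ne x 0 with rfl | hx
    · exact ⟨{0}, Set.mem_insert _ _, rfl⟩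
    · obtain ⟨n, hn⟩ := exists_nat_one_div_lt (norm_pos_iff.2 hx)
      exact ⟨_, Set.mem_insert_of_mem _ ⟨n, rfl⟩, hn⟩

/-- Both measures may be infinite, but they are σ-finite, so the difference is built from the
density `1 - dν₂/dν₁`. It serves as the Lévy measure of the cofactor. -/
theorem IsLevyMeasure.exists_add_eq_of_le (hν : IsLevyMeasure ν₁) (h : ν₂ ≤ ν₁) :
    ∃ κ, κ + ν₂ = ν₁ := by
  have h₁ := hν.sigmaFinite
  have h₂ := (hν.mono h).sigmaFinite
  refine ⟨ν₁.withDensity (1 - ν₂.rnDeriv ν₁), ?_⟩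
  have hd : ν₂ = ν₁.withDensity (ν₂.rnDeriv ν₁) :=
    (Measure.withDensity_rnDeriv_eq _ _ (Measure.absolutelyContinuous_of_le h)).symm
  conv_lhs => rw [hd]
  conv_rhs => rw [← withDensity_one (μ := ν₁)]
  rw [← withDensity_add_right _ (Measure.measurable_rnDeriv _ _), ← hd]
  refine withDensity_congr_ae ?_
  filter_upwards [Measure.rnDeriv_le_one_of_le h] with x hx
  exact tsub_add_cancel_of_le hx

theorem HasLevyTriplet.isDistinguishedLog (hμ : HasLevyTriplet μ 0 ν γ) :
    IsDistinguishedLog μ fun z => levyExponent ν z + (inner ℝ γ z : ℝ) * Complex.I := by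
  obtain ⟨hν, hf⟩ := hasLevyTriplet_zero_iff.1 hμ
  have := hν.continuous_levyExponent
  exact ⟨by fun_prop, by simp, fun z => (hf z).symm⟩

theorem IsDistinguishedLog.unique {ψ₁ ψ₂ : EuclideanSpace ℝ (Fin d) → ℂ}
    (h₁ : IsDistinguishedLog μ ψ₁) (h₂ : IsDistinguishedLog μ ψ₂) : ψ₁ = ψ₂ :=
  h₁.continuous.eq_of_exp_eq h₂.continuous (x₀ := 0)
    (fun z => (h₁.exp_eq z).trans (h₂.exp_eq z).symm) (h₁.map_zero.trans h₂.map_zero.symm)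

/-- A factor `μ̂(c z)^s` splits off from `μ̂` in the class `ID` if and only if `ν_μ` dominates
the rescaled Lévy measure. -/
theorem HasLevyTriplet.exists_factor_iff (hμ : HasLevyTriplet μ 0 ν γ) {s c : ℝ} (hs : 0 ≤ s)
    (hc : 0 < c) {ψ : EuclideanSpace ℝ (Fin d) → ℂ} (hψ : IsDistinguishedLog μ ψ) :
    (∃ ρ : Measure (EuclideanSpace ℝ (Fin d)), IsInfinitelyDivisible ρ ∧
      ∀ z, charFun μ z = Complex.exp ((s : ℂ) * ψ (c • z)) * charFun ρ z) ↔
    ENNReal.ofReal s • ν.map (c • ·) ≤ ν := by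
  obtain ⟨hν, hf⟩ := hasLevyTriplet_zero_iff.1 hμ
  obtain rfl := hψ.unique hμ.isDistinguishedLog
  obtain ⟨δ, hδ⟩ := hν.exists_levyExponent_smul_eq hc
  have hνs := (hν.map_smul hc).smul (c := ENNReal.ofReal s) ENNReal.ofReal_ne_top
  have hexp : ∀ z, (s : ℂ) * (levyExponent ν (c • z) + (inner ℝ γ (c • z) : ℝ) * Complex.I)
      = levyExponent (ENNReal.ofReal s • ν.map (c • ·)) z
        + (inner ℝ (s • δ + (s * c) • γ) z : ℝ) * Complex.I := by
    intro z
    rw [hδ, levyExponent_smul hs, inner_add_left, real_inner_smul_left, real_inner_smul_left,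
      inner_smul_right]
    push_cast
    ring
  constructor
  · rintro ⟨ρ, hρ, h⟩
    refine hρ.levyMeasure_le hν hνs (γ := γ - (s • δ + (s * c) • γ)) fun z => ?_
    have h1 := h z
    rw [hexp, hf] at h1
    rw [inner_sub_left, Complex.ofReal_sub]
    rw [show levyExponent ν z - levyExponent (ENNReal.ofReal s • ν.map (c • ·)) z
        + (((inner ℝ γ z : ℝ) : ℂ) - ((inner ℝ (s • δ + (s * c) • γ) z : ℝ) : ℂ)) * Complex.I
        = (levyExponent ν z + (inner ℝ γ z : ℝ) * Complex.I)
          - (levyExponent (ENNReal.ofReal s • ν.map (c • ·)) z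
            + (inner ℝ (s • δ + (s * c) • γ) z : ℝ) * Complex.I) by ring,
      Complex.exp_sub, h1, mul_div_cancel_left₀ _ (Complex.exp_ne_zero _)]
  · intro hle
    obtain ⟨κ, hκ⟩ := hν.exists_add_eq_of_le hle
    have hκL : IsLevyMeasure κ := hν.mono (hκ ▸ Measure.le_add_right le_rfl)
    obtain ⟨ρ, hρ, hρt⟩ := hκL.exists_hasLevyTriplet (γ - (s • δ + (s * c) • γ))
    refine ⟨ρ, hρ, fun z => ?_⟩
    rw [hexp, hf, (hasLevyTriplet_zero_iff.1 hρt).2, ← Complex.exp_add]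
    congr 1
    conv_lhs => rw [← hκ, levyExponent_add hκL hνs]
    rw [inner_sub_left]
    push_cast
    ring

theorem HasLevyTriplet.isSelfdecomposableOfIndex_iff (hμ : HasLevyTriplet μ 0 ν γ)
    (hid : IsInfinitelyDivisible μ) (α : ℝ) :
    IsSelfdecomposableOfIndex α μ ↔
      ∀ b : ℝ, 1 < b → ENNReal.ofReal (b ^ α) • ν.map (b⁻¹ • ·) ≤ ν := by
  constructor
  · rintro ⟨-, ψ, hψ, h⟩ b hb
    have : 0 < b := by linarith
    exact (hμ.exists_factor_iff (by positivity) (by positivity) hψ).1 (h b hb)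
  · intro h
    refine ⟨hid, _, hμ.isDistinguishedLog, fun b hb => ?_⟩
    have : 0 < b := by linarith
    exact (hμ.exists_factor_iff (by positivity) (by positivity)
      hμ.isDistinguishedLog).2 (h b hb)

theorem HasLevyTriplet.isDualSelfdecomposableOfIndex_iff (hμ : HasLevyTriplet μ 0 ν γ)
    (hid : IsInfinitelyDivisible μ) (α : ℝ) :
    IsDualSelfdecomposableOfIndex α μ ↔
      ∀ b : ℝ, 1 < b → ENNReal.ofReal (b ^ (α - 2)) • ν.map (b • ·) ≤ ν := by
  constructor
  · rintro ⟨-, ψ, hψ, h⟩ b hb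
    have : 0 < b := by linarith
    exact (hμ.exists_factor_iff (by positivity) this hψ).1 (h b hb)
  · intro h
    refine ⟨hid, _, hμ.isDistinguishedLog, fun b hb => ?_⟩
    have : 0 < b := by linarith
    exact (hμ.exists_factor_iff (by positivity) this
      hμ.isDistinguishedLog).2 (h b hb)

end Scaling

/-! ### Inversion of Lévy measures. -/

section Inversion

variable {d : ℕ} {ν ν₁ ν₂ : Measure (EuclideanSpace ℝ (Fin d))}

theorem measurable_geometricInversion :
    Measurable (geometricInversion : EuclideanSpace ℝ (Fin d) → EuclideanSpace ℝ (Fin d)) := by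
  unfold geometricInversion
  fun_prop

theorem norm_geometricInversion (x : EuclideanSpace ℝ (Fin d)) :
    ‖geometricInversion x‖ = ‖x‖⁻¹ := by
  rw [geometricInversion, norm_smul, Real.norm_of_nonneg (by positivity)]
  rcases eq_or_ne ‖x‖ 0 with h | h
  · simp [h]
  · field_simp

theorem geometricInversion_geometricInversion (x : EuclideanSpace ℝ (Fin d)) :
    geometricInversion (geometricInversion x) = x := by
  rw [geometricInversion, norm_geometricInversion, geometricInversion, smul_smul]
  rcases eq_or_ne x 0 with rfl | h
  · simp
  · have : ‖x‖ ≠ 0 := norm_ne_zero_iff.2 h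
    rw [inv_pow, inv_inv, mul_inv_cancel₀ (by positivity), one_smul]

theorem geometricInversion_smul (c : ℝ) (x : EuclideanSpace ℝ (Fin d)) :
    geometricInversion (c • x) = c⁻¹ • geometricInversion x := by
  rcases eq_or_ne c 0 with rfl | hc
  · simp [geometricInversion]
  · rw [geometricInversion, geometricInversion, norm_smul, smul_smul, smul_smul, mul_pow,
      Real.norm_eq_abs, sq_abs]
    congr 1
    field_simp

/-- The image of `|x|² ν(dx)` under the geometric inversion. -/
noncomputable def levyInversion (ν : Measure (EuclideanSpace ℝ (Fin d))) :
    Measure (EuclideanSpace ℝ (Fin d)) :=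
  (ν.withDensity fun x => ENNReal.ofReal (‖x‖ ^ 2)).map geometricInversion

theorem lintegral_levyInversion {f : EuclideanSpace ℝ (Fin d) → ENNReal} (hf : Measurable f) :
    ∫⁻ x, f x ∂levyInversion ν =
      ∫⁻ x, f (geometricInversion x) * ENNReal.ofReal (‖x‖ ^ 2) ∂ν := by
  have hg : Measurable fun x => f (geometricInversion x) := hf.comp measurable_geometricInversion
  rw [levyInversion, lintegral_map hf measurable_geometricInversion,
    lintegral_withDensity_eq_lintegral_mul _ (by fun_prop) hg]
  simp [mul_comm]

theorem measurable_indicator_geometricInversion_mul {B : Set (EuclideanSpace ℝ (Fin d))}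
    (hB : MeasurableSet B) : Measurable fun x : EuclideanSpace ℝ (Fin d) =>
      B.indicator (1 : EuclideanSpace ℝ (Fin d) → ENNReal) (geometricInversion x)
        * ENNReal.ofReal (‖x‖ ^ 2) :=
  ((measurable_one.indicator hB).comp measurable_geometricInversion).mul (by fun_prop)

theorem levyInversion_apply {B : Set (EuclideanSpace ℝ (Fin d))} (hB : MeasurableSet B) :
    levyInversion ν B = ∫⁻ x, B.indicator 1 (geometricInversion x) * ENNReal.ofReal (‖x‖ ^ 2) ∂ν := by
  rw [← lintegral_levyInversion (measurable_one.indicator hB), lintegral_indicator_one hB]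

theorem setLIntegral_compl_zero_eq (B : Set (EuclideanSpace ℝ (Fin d))) :
    ∫⁻ x in {0}ᶜ, B.indicator 1 (geometricInversion x) * ENNReal.ofReal (‖x‖ ^ 2) ∂ν =
      ∫⁻ x, B.indicator 1 (geometricInversion x) * ENNReal.ofReal (‖x‖ ^ 2) ∂ν := by
  rw [← lintegral_indicator (measurableSet_singleton 0).compl]
  congr with x
  rcases eq_or_ne x 0 with rfl | hx
  · simp
  · rw [Set.indicator_of_mem (by simpa using hx)]

theorem eq_levyInversion_iff :
    (∀ B : Set (EuclideanSpace ℝ (Fin d)), MeasurableSet B →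
      ν₂ B = ∫⁻ x in {0}ᶜ,
        B.indicator 1 (geometricInversion x) * ENNReal.ofReal (‖x‖ ^ 2) ∂ν₁) ↔
    ν₂ = levyInversion ν₁ := by
  simp_rw [setLIntegral_compl_zero_eq]
  constructor
  · exact fun h => Measure.ext fun B hB => by rw [h B hB, levyInversion_apply hB]
  · rintro rfl B hB
    exact levyInversion_apply hB

/-- For `x ≠ 0`, `|x|² (|x|⁻² ∧ 1) = 1 ∧ |x|²`, so the integrability condition is preserved. -/
theorem IsLevyMeasure.levyInversion (hν : IsLevyMeasure ν) : IsLevyMeasure (levyInversion ν) := by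
  constructor
  · rw [levyInversion_apply (measurableSet_singleton 0)]
    refine (lintegral_congr fun x => ?_).trans lintegral_zero
    rcases eq_or_ne x 0 with rfl | hx
    · simp
    · have : geometricInversion x ≠ 0 := by
        rw [← norm_ne_zero_iff, norm_geometricInversion]
        simpa using hx
      simp [this]
  · rw [lintegral_levyInversion (by fun_prop)]
    refine (lintegral_mono fun x => ?_).trans_lt hν.2
    rw [norm_geometricInversion, ← ENNReal.ofReal_mul (by positivity)]
    refine ENNReal.ofReal_le_ofReal ?_
    rw [min_mul_of_nonneg _ _ (by positivity), one_mul, min_comm (‖x‖ ^ 2)]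
    refine min_le_min ?_ le_rfl
    rw [inv_pow]
    exact inv_mul_le_one

theorem levyInversion_mono (h : ν₁ ≤ ν₂) : levyInversion ν₁ ≤ levyInversion ν₂ := by
  refine Measure.le_iff.2 fun B hB => ?_
  rw [levyInversion_apply hB, levyInversion_apply hB]
  exact lintegral_mono' h le_rfl

/-- The weights `|x|²` and `|ι(x)|² = |x|⁻²` cancel off the origin. Mass at 0 must be excluded
because the weight erases it. -/
theorem levyInversion_levyInversion (h : ν {0} = 0) : levyInversion (levyInversion ν) = ν := by
  refine Measure.ext fun B hB => ?_
  rw [levyInversion_apply hB, lintegral_levyInversion (measurable_indicator_geometricInversion_mul hB),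
    ← lintegral_indicator_one hB]
  refine lintegral_congr_ae ?_
  have h0 : ∀ᵐ x ∂ν, x ≠ 0 := by
    rw [ae_iff]
    simpa using h
  filter_upwards [h0] with x hx
  have : ‖x‖ ≠ 0 := norm_ne_zero_iff.2 hx
  simp only [geometricInversion_geometricInversion, norm_geometricInversion]
  rw [mul_assoc, ← ENNReal.ofReal_mul (by positivity), ← mul_pow, inv_mul_cancel₀ this]
  simp

theorem levyInversion_smul_map {s c : ℝ} (hc : c ≠ 0) :
    levyInversion (ENNReal.ofReal s • ν.map (c • ·)) =
      ENNReal.ofReal (s * c ^ 2) • (levyInversion ν).map (c⁻¹ • ·) := by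
  have hm : ∀ c : ℝ, Measurable (fun x : EuclideanSpace ℝ (Fin d) => c • x) := fun c => by fun_prop
  refine Measure.ext fun B hB => ?_
  have hBm : Measurable (fun x : EuclideanSpace ℝ (Fin d) =>
      B.indicator (1 : EuclideanSpace ℝ (Fin d) → ENNReal) (c⁻¹ • x)) := (measurable_one.indicator hB).comp (hm _)
  have hgm : Measurable (fun x : EuclideanSpace ℝ (Fin d) =>
      B.indicator (1 : EuclideanSpace ℝ (Fin d) → ENNReal) (c⁻¹ • geometricInversion x)
        * ENNReal.ofReal (‖x‖ ^ 2)) := (hBm.comp measurable_geometricInversion).mul (by fun_prop)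
  have hrhs : (levyInversion ν).map (c⁻¹ • ·) B =
      ∫⁻ x, B.indicator 1 (c⁻¹ • geometricInversion x) * ENNReal.ofReal (‖x‖ ^ 2) ∂ν := by
    rw [← lintegral_indicator_one hB, lintegral_map (measurable_one.indicator hB) (hm _),
      lintegral_levyInversion hBm]
  rw [levyInversion_apply hB, lintegral_smul_measure, lintegral_map
    (measurable_indicator_geometricInversion_mul hB) (hm _),
    Measure.smul_apply, hrhs, ENNReal.ofReal_mul' (by positivity), smul_eq_mul, smul_eq_mul,
    mul_assoc, ← lintegral_const_mul _ hgm]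
  congr 1
  refine lintegral_congr fun x => ?_
  rw [geometricInversion_smul, norm_smul, mul_pow, Real.norm_eq_abs, sq_abs,
    ENNReal.ofReal_mul (by positivity)]
  ring

/-- Each direction applies the monotone involution once; the factor `c²` turns `b^(α-2)` into `b^α`
for `c = b` and back for `c = b⁻¹`. -/
theorem levyInversion_dilation_le_iff (hν : ν {0} = 0) (α : ℝ) {b : ℝ} (hb : 0 < b) :
    ENNReal.ofReal (b ^ (α - 2)) • (levyInversion ν).map (b • ·) ≤ levyInversion ν ↔
      ENNReal.ofReal (b ^ α) • ν.map (b⁻¹ • ·) ≤ ν := by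
  constructor
  · intro h
    have := levyInversion_mono h
    rwa [levyInversion_smul_map hb.ne', levyInversion_levyInversion hν, ← Real.rpow_natCast,
      ← Real.rpow_add hb, Nat.cast_ofNat, sub_add_cancel] at this
  · intro h
    have := levyInversion_mono h
    rwa [levyInversion_smul_map (inv_ne_zero hb.ne'), inv_inv, inv_pow, ← div_eq_mul_inv,
      ← Real.rpow_natCast, ← Real.rpow_sub hb, Nat.cast_ofNat] at this

end Inversion

/-! ### The main theorem. -/

theorem theorem4p4 (d : ℕ) (α : ℝ) (μ : MeasureTheory.Measure (EuclideanSpace ℝ (Fin d)))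
    (hμ : IsInfinitelyDivisibleZero μ) :
    (∃! μ' : MeasureTheory.Measure (EuclideanSpace ℝ (Fin d)), IsInversion μ μ') ∧
    ∀ μ' : MeasureTheory.Measure (EuclideanSpace ℝ (Fin d)), IsInversion μ μ' →
      (IsSelfdecomposableOfIndex α μ ↔ IsDualSelfdecomposableOfIndex α μ') := by
  obtain ⟨hid, ν, γ, ht⟩ := hμ
  -- The triplets in `IsInversion` are existentially quantified; uniqueness of the triplet of `μ`
  -- ties them to the fixed `ν` and `γ`.
  have key : ∀ μ', IsInversion μ μ' → IsInfinitelyDivisible μ' ∧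
      HasLevyTriplet μ' 0 (levyInversion ν)
        (-γ + ∫ x in Metric.sphere (0 : EuclideanSpace ℝ (Fin d)) 1, x ∂ν) := by
    rintro μ' ⟨-, ⟨hid', -⟩, ν₁, ν', γ₁, γ', ht₁, ht', hν', hγ'⟩
    obtain ⟨rfl, rfl⟩ := ht.unique ht₁
    rw [eq_levyInversion_iff.1 hν', hγ'] at ht'
    exact ⟨hid', ht'⟩
  refine ⟨?_, fun μ' hμ' => ?_⟩
  · obtain ⟨μ', hid', ht'⟩ := ht.levyMeasure.levyInversion.exists_hasLevyTriplet
      (-γ + ∫ x in Metric.sphere (0 : EuclideanSpace ℝ (Fin d)) 1, x ∂ν)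
    refine ⟨μ', ⟨⟨hid, ν, γ, ht⟩, ⟨hid', _, _, ht'⟩, _, _, _, _, ht, ht',
      eq_levyInversion_iff.2 rfl, rfl⟩, fun κ hκ => ?_⟩
    obtain ⟨hκid, hκt⟩ := key κ hκ
    have := hκid.1
    have := hid'.1
    refine Measure.ext_of_charFun (funext fun z => ?_)
    rw [hκt.charFun_eq, ht'.charFun_eq]
  · obtain ⟨hid', ht'⟩ := key μ' hμ'
    rw [ht.isSelfdecomposableOfIndex_iff hid, ht'.isDualSelfdecomposableOfIndex_iff hid']
    refine forall₂_congr fun b hb => ?_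
    exact (levyInversion_dilation_le_iff ht.levyMeasure.1 α (by linarith)).symm
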